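/- Let $k\in\mathbb Z$. For a discrete subgroup $\Gamma\subset \mathrm{PSL}_2(\mathbb R)$, acting on the upper half-plane $\mathbb H$ by Möbius transformations, let $\mathfrak F_k=\mathfrak F_k(\Gamma)$ be the space of functions $f:\mathbb H\to\mathbb C$ with $$f(\gamma z)=\Big(\frac{cz+d}{c\bar z+d}\Big)^k f(z)\qquad\text{for all } \gamma=\pm\begin{pmatrix}a&b\\c&d\end{pmatrix}\in\Gamma,\ z\in\mathbb H .$$ Let $$\Delta_k=y^2\Big(\frac{\partial^2}{\partial x^2}+\frac{\partial^2}{\partial y^2}\Big)-2iky\frac{\partial}{\partial x},\qquad K_k=(z-\bar z)\frac{\partial}{\partial z}+k,\qquad L_k=(\bar z-z)\frac{\partial}{\partial\bar z}-k,$$ where $z=x+iy$. A function $f\in\mathfrak F_k$ is called an eigenfunction of $\Delta_k$ with eigenvalue $s(1-s)$, where $s\in\mathbb C$, if it is twice continuously differentiable and $\Delta_k f+s(1-s)f=0$ on $\mathbb H$. For $C\subseteq\Gamma\backslash\mathbb H$ and $f:\mathbb H\to\mathbb C$ let $\|f\|_{\infty,C}\in[0,\infty]$ be the supremum of $|f(z)|$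 over all $z\in\mathbb H$ whose class in $\Gamma\backslash\mathbb H$ lies in $C$. **Lemma.** For every $k\in\mathbb Z$ and every $\delta>0$ there is a constant $M=M(k,\delta)\ge 0$ such that for every discrete subgroup $\Gamma\subset\mathrm{PSL}_2(\mathbb R)$ and every compact $C\subseteq\Gamma\backslash\mathbb H$ there is a compact $C'\subseteq\Gamma\backslash\mathbb H$ with $C\subseteq C'$ for which $$\|K_kf\|_{\infty,C}\le M\,|s|\,\|f\|_{\infty,C'}\qquad\text{and}\qquad \|L_kf\|_{\infty,C}\le M\,|s|\,\|f\|_{\infty,C'}$$ hold for all $s\in\mathbb C$ with $|s|\ge\delta$ and all eigenfunctions $f\in\mathfrak F_k$ of $\Delta_k$ with eigenvalue $s(1-s)$. (For $s=\tfrac12+it$ with $t\in\mathbb R$ one may take $\delta=\tfrac12$, and then $M$ depends only on $k$.) -/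

import Mathlib

open scoped UpperHalfPlane MatrixGroups NNReal ENNReal

noncomputable section

namespace WeightK

/-- The preimage in `SL(2, ℝ)` of a subgroup of `PSL(2, ℝ)`. It acts on `ℍ` by Möbius
transformations, with the same orbits as the given subgroup of `PSL(2, ℝ)`. -/
def lift (Γ : Subgroup PSL(2, ℝ)) : Subgroup SL(2, ℝ) :=
  Γ.comap (QuotientGroup.mk' (Subgroup.center SL(2, ℝ)))

/-- The quotient `Γ\ℍ`, with the quotient topology. -/
abbrev Surface (Γ : Subgroup PSL(2, ℝ)) : Type :=
  MulAction.orbitRel.Quotient (lift Γ) ℍ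

/-- The projection `ℍ → Γ\ℍ`. -/
def proj (Γ : Subgroup PSL(2, ℝ)) (z : ℍ) : Surface Γ :=
  Quotient.mk _ z

/-- The space `𝔉_k` of functions with `f (γ z) = ((c z + d) / (c z̄ + d)) ^ k * f z` for all
`γ ∈ Γ` with lower row `(c, d)`; the factor does not depend on the sign of `(c, d)`. -/
def Automorphic (Γ : Subgroup PSL(2, ℝ)) (k : ℤ) : Set (ℍ → ℂ) :=
  {f | ∀ γ ∈ lift Γ, ∀ z : ℍ,
    f (γ • z) =
      (((γ 1 0 : ℝ) * (z : ℂ) + (γ 1 1 : ℝ)) /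
        ((γ 1 0 : ℝ) * (starRingEnd ℂ) (z : ℂ) + (γ 1 1 : ℝ))) ^ k * f z}

/-- The partial derivative `∂f/∂x`, where `z = x + i y`. -/
def dx (f : ℍ → ℂ) (z : ℍ) : ℂ :=
  fderiv ℝ (f ∘ UpperHalfPlane.ofComplex) (z : ℂ) 1

/-- The partial derivative `∂f/∂y`, where `z = x + i y`. -/
def dy (f : ℍ → ℂ) (z : ℍ) : ℂ :=
  fderiv ℝ (f ∘ UpperHalfPlane.ofComplex) (z : ℂ) Complex.I

/-- The derivative `∂f/∂z = (∂f/∂x - i ∂f/∂y) / 2`. -/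
def dz (f : ℍ → ℂ) (z : ℍ) : ℂ :=
  (dx f z - Complex.I * dy f z) / 2

/-- The derivative `∂f/∂z̄ = (∂f/∂x + i ∂f/∂y) / 2`. -/
def dzbar (f : ℍ → ℂ) (z : ℍ) : ℂ :=
  (dx f z + Complex.I * dy f z) / 2

/-- The `k`-Laplacian `Δ_k = y² (∂²/∂x² + ∂²/∂y²) - 2 i k y ∂/∂x`. -/
def laplacian (k : ℤ) (f : ℍ → ℂ) (z : ℍ) : ℂ :=
  (z.im : ℂ) ^ 2 * (dx (dx f) z + dy (dy f) z) - 2 * Complex.I * k * z.im * dx f z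

/-- The raising operator `K_k = (z - z̄) ∂/∂z + k`. -/
def raising (k : ℤ) (f : ℍ → ℂ) (z : ℍ) : ℂ :=
  ((z : ℂ) - (starRingEnd ℂ) (z : ℂ)) * dz f z + k * f z

/-- The lowering operator `L_k = (z̄ - z) ∂/∂z̄ - k`. -/
def lowering (k : ℤ) (f : ℍ → ℂ) (z : ℍ) : ℂ :=
  ((starRingEnd ℂ) (z : ℂ) - (z : ℂ)) * dzbar f z - k * f z

/-- `f ∈ 𝔉_k` is a (twice continuously differentiable) solution of `Δ_k f + s (1 - s) f = 0`. -/
structure IsEigenfunction (Γ : Subgroup PSL(2, ℝ)) (k : ℤ) (s : ℂ) (f : ℍ → ℂ) : Prop where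
  automorphic : f ∈ Automorphic Γ k
  contDiffOn : ContDiffOn ℝ 2 (f ∘ UpperHalfPlane.ofComplex) {w : ℂ | 0 < w.im}
  eigen : ∀ z : ℍ, laplacian k f z + s * (1 - s) * f z = 0

/-- The sup norm `‖f‖_{∞, C}`, with values in `[0, ∞]`, for `C ⊆ Γ\ℍ`: the supremum of `|f z|`
over all `z ∈ ℍ` that lie over a point of `C`. For `f ∈ 𝔉_k` the function `|f|` is constant on
`Γ`-orbits, so this is the supremum over `C` of the function that `|f|` induces on `Γ\ℍ`. -/
def supNorm (Γ : Subgroup PSL(2, ℝ)) (C : Set (Surface Γ)) (f : ℍ → ℂ) : ℝ≥0∞ :=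
  ⨆ z ∈ {z : ℍ | proj Γ z ∈ C}, ‖f z‖ₑ

end WeightK

end

/-!
The bound is an interior gradient estimate for the elliptic equation `Δ_k f + s (1 - s) f = 0`,
made uniform in the base point by the scale invariance of the equation.

For `Δ u = h` on a square of side `2 d`, comparison of the odd part of `u` with a quadratic barrier
through the minimum principle (`deriv_le_of_laplacian_lt`) gives
`|∇u| ≲ sup |u| / d + d * sup |h|` at the centre (`norm_px_add_norm_py_le`).
Divided by `y²`, the eigenvalue equation reads `Δ f = -s (1 - s) f / y² + 2 i k f_x / y`. On a disc
of radius `R = y₀ / (16 (|k| + 1) (1 + |s|))` around `z₀ = x₀ + i y₀` the coefficients are comparable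
to their values at `z₀`, the first term on the right contributes `R² |s (1 - s)| / y₀² * sup |f|`, a
bounded multiple of `sup |f|`, and the gradient term is absorbed by maximizing
`(R - |z - z₀|) |∇f(z)|` over the disc (`mul_norm_px_add_norm_py_le`).
Hence `y₀ |∇f(z₀)| ≲ (1 + |s|) sup |f|`, the supremum being over the hyperbolic disc of radius `1`
around `z₀` (`im_mul_gradient_le`), and `1 + |s| ≤ (1 + 1 / δ) |s|`.

Since `Γ` acts by isometries, a compact `C ⊆ Γ\ℍ` has a compact neighbourhood that contains the
projections of all hyperbolic discs of radius `1` around points above `C`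
(`exists_isCompact_thickening`); this is `C'`.
-/

namespace WeightK

open Set Filter Topology

/-! ### The minimum principle and a barrier -/

/-- The necessary second-order condition at a local minimum. -/
lemma secondDeriv_nonneg_of_isLocalMin {g g' : ℝ → ℝ} {x c : ℝ} (hmin : IsLocalMin g x)
    (hg : ∀ᶠ t in 𝓝 x, HasDerivAt g (g' t) t) (hg' : HasDerivAt g' c x) : 0 ≤ c := by
  by_contra! hc
  have hderiv : deriv g =ᶠ[𝓝 x] g' := hg.mono fun t ht => ht.deriv
  have hmax : IsLocalMax g x := by
    refine isLocalMax_of_deriv_deriv_neg ?_ hmin.deriv_eq_zero hg.self_of_nhds.continuousAt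
    rwa [hderiv.deriv_eq, hg'.deriv]
  -- `g` is both minimal and maximal at `x`, hence constant nearby, so its second derivative is `0`.
  have hconst : g =ᶠ[𝓝 x] fun _ => g x := by
    filter_upwards [hmin, hmax] with t h₁ h₂ using le_antisymm h₂ h₁
  have hzero : deriv g =ᶠ[𝓝 x] fun _ => 0 := by
    simpa using hconst.deriv
  have h := hderiv.deriv_eq
  rw [hzero.deriv_eq, hg'.deriv, deriv_const] at h
  exact hc.ne h.symm

/-- The minimum principle on a rectangle: a function with negative Laplacian that is nonnegative
on the boundary is nonnegative. -/
lemma nonneg_of_laplacian_neg {a b c e : ℝ} {w wx wy wxx wyy : ℝ → ℝ → ℝ}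
    (hc : ContinuousOn (Function.uncurry w) (Icc a b ×ˢ Icc c e))
    (hx : ∀ x ∈ Ioo a b, ∀ y ∈ Ioo c e, HasDerivAt (fun t => w t y) (wx x y) x)
    (hy : ∀ x ∈ Ioo a b, ∀ y ∈ Ioo c e, HasDerivAt (fun t => w x t) (wy x y) y)
    (hxx : ∀ x ∈ Ioo a b, ∀ y ∈ Ioo c e, HasDerivAt (fun t => wx t y) (wxx x y) x)
    (hyy : ∀ x ∈ Ioo a b, ∀ y ∈ Ioo c e, HasDerivAt (fun t => wy x t) (wyy x y) y)
    (hΔ : ∀ x ∈ Ioo a b, ∀ y ∈ Ioo c e, wxx x y + wyy x y < 0)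
    (hbd : ∀ x ∈ Icc a b, ∀ y ∈ Icc c e, x = a ∨ x = b ∨ y = c ∨ y = e → 0 ≤ w x y)
    {x y : ℝ} (hxm : x ∈ Icc a b) (hym : y ∈ Icc c e) : 0 ≤ w x y := by
  obtain ⟨⟨p, q⟩, ⟨hp, hq⟩, hmin⟩ :=
    (isCompact_Icc.prod isCompact_Icc).exists_isMinOn ⟨(x, y), hxm, hym⟩ hc
  refine le_trans ?_ (hmin (show (x, y) ∈ Icc a b ×ˢ Icc c e from ⟨hxm, hym⟩))
  change 0 ≤ w p q
  by_cases hpq : p = a ∨ p = b ∨ q = c ∨ q = e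
  · exact hbd p hp q hq hpq
  push Not at hpq
  have hp' : p ∈ Ioo a b := ⟨lt_of_le_of_ne hp.1 (Ne.symm hpq.1), lt_of_le_of_ne hp.2 hpq.2.1⟩
  have hq' : q ∈ Ioo c e :=
    ⟨lt_of_le_of_ne hq.1 (Ne.symm hpq.2.2.1), lt_of_le_of_ne hq.2 hpq.2.2.2⟩
  have hpn := Ioo_mem_nhds hp'.1 hp'.2
  have hqn := Ioo_mem_nhds hq'.1 hq'.2
  have h₁ : 0 ≤ wxx p q := by
    refine secondDeriv_nonneg_of_isLocalMin (g := fun t => w t q) (g' := fun t => wx t q) ?_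
      (by filter_upwards [hpn] with t ht using hx t ht q hq') (hxx p hp' q hq')
    filter_upwards [hpn] with t ht
    exact hmin (show (t, q) ∈ Icc a b ×ˢ Icc c e from ⟨Ioo_subset_Icc_self ht, hq⟩)
  have h₂ : 0 ≤ wyy p q := by
    refine secondDeriv_nonneg_of_isLocalMin (g := fun t => w p t) (g' := fun t => wy p t) ?_
      (by filter_upwards [hqn] with t ht using hy p hp' t ht) (hyy p hp' q hq')
    filter_upwards [hqn] with t ht
    exact hmin (show (p, t) ∈ Icc a b ×ˢ Icc c e from ⟨hp, Ioo_subset_Icc_self ht⟩)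
  linarith [hΔ p hp' q hq']

lemma hasDerivAt_nonneg_of_nonneg_right {h : ℝ → ℝ} {c d : ℝ} (hd : 0 < d) (h0 : h 0 = 0)
    (hh : ∀ t ∈ Ioc 0 d, 0 ≤ h t) (hc : HasDerivAt h c 0) : 0 ≤ c := by
  have ht := hc.tendsto_slope_zero_right
  refine ge_of_tendsto ht ?_
  filter_upwards [Ioc_mem_nhdsGT hd] with t htd
  have := hh t htd
  simp only [zero_add, h0, sub_zero, smul_eq_mul]
  exact mul_nonneg (inv_nonneg.2 htd.1.le) this

/-- One-sided interior gradient estimate for the Poisson equation on a square. The odd part of `g`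
in `y`, which vanishes for `y = 0`, is compared on the upper half of the square with the barrier
`A / d² * (x² + y (2 d - y)) + B / 2 * y (d - y)`, whose Laplacian is `-B`. -/
lemma deriv_le_of_laplacian_lt {d A B : ℝ} (hd : 0 < d) {g gx gy gxx gyy : ℝ → ℝ → ℝ}
    (hc : ContinuousOn (Function.uncurry g) (Icc (-d) d ×ˢ Icc (-d) d))
    (hx : ∀ x ∈ Icc (-d) d, ∀ y ∈ Icc (-d) d, HasDerivAt (fun t => g t y) (gx x y) x)
    (hy : ∀ x ∈ Icc (-d) d, ∀ y ∈ Icc (-d) d, HasDerivAt (fun t => g x t) (gy x y) y)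
    (hxx : ∀ x ∈ Icc (-d) d, ∀ y ∈ Icc (-d) d, HasDerivAt (fun t => gx t y) (gxx x y) x)
    (hyy : ∀ x ∈ Icc (-d) d, ∀ y ∈ Icc (-d) d, HasDerivAt (fun t => gy x t) (gyy x y) y)
    (hA : ∀ x ∈ Icc (-d) d, ∀ y ∈ Icc (-d) d, |g x y| ≤ A)
    (hB : ∀ x ∈ Icc (-d) d, ∀ y ∈ Icc (-d) d, |gxx x y + gyy x y| < B) :
    gy 0 0 ≤ 2 * A / d + B * d / 2 := by
  have hneg : ∀ y ∈ Icc 0 d, -y ∈ Icc (-d) d := fun y hy => ⟨by linarith [hy.2], by linarith [hy.1]⟩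
  have hpos : ∀ y ∈ Icc 0 d, y ∈ Icc (-d) d := fun y hy => ⟨by linarith [hy.1], hy.2⟩
  have h0 : (0 : ℝ) ∈ Icc (-d) d := ⟨by linarith, hd.le⟩
  have hA0 : 0 ≤ A := (abs_nonneg _).trans (hA 0 h0 0 h0)
  have hB0 : 0 < B := (abs_nonneg _).trans_lt (hB 0 h0 0 h0)
  have hrefl : ∀ {h h' : ℝ → ℝ} {y : ℝ}, HasDerivAt h (h' (-y)) (-y) →
      HasDerivAt (fun t => h (-t)) (-h' (-y)) y := by
    intro h h' y hh
    exact (HasDerivAt.comp y hh (hasDerivAt_neg y)).congr_deriv (by simp)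
  have key : ∀ y ∈ Icc 0 d, 0 ≤ A / d ^ 2 * (0 ^ 2 + y * (2 * d - y)) + B / 2 * (y * (d - y))
      - (g 0 y - g 0 (-y)) / 2 := by
    intro y hym
    refine nonneg_of_laplacian_neg (a := -d) (b := d) (c := 0) (e := d)
      (w := fun x y => A / d ^ 2 * (x ^ 2 + y * (2 * d - y)) + B / 2 * (y * (d - y))
        - (g x y - g x (-y)) / 2)
      (wx := fun x y => A / d ^ 2 * (2 * x) - (gx x y - gx x (-y)) / 2)
      (wy := fun x y => A / d ^ 2 * (2 * d - 2 * y) + B / 2 * (d - 2 * y)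
        - (gy x y + gy x (-y)) / 2)
      (wxx := fun x y => A / d ^ 2 * 2 - (gxx x y - gxx x (-y)) / 2)
      (wyy := fun x y => A / d ^ 2 * (-2) + B / 2 * (-2) - (gyy x y - gyy x (-y)) / 2)
      ?_ ?_ ?_ ?_ ?_ ?_ ?_ h0 hym
    · refine ContinuousOn.sub (by fun_prop) (ContinuousOn.div_const (ContinuousOn.sub ?_ ?_) 2)
      · exact hc.mono (prod_mono le_rfl fun y hy => hpos y hy)
      · exact hc.comp (f := fun p : ℝ × ℝ => (p.1, -p.2)) (by fun_prop)
          fun p hp => ⟨hp.1, hneg _ hp.2⟩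
    · intro x hxm y hym
      have hxm := Ioo_subset_Icc_self hxm
      have hym := Ioo_subset_Icc_self hym
      have h1 := ((((hasDerivAt_id x).pow 2).add_const (y * (2 * d - y))).const_mul
        (A / d ^ 2)).add_const (B / 2 * (y * (d - y)))
      have h2 := ((hx x hxm y (hpos y hym)).sub (hx x hxm (-y) (hneg y hym))).div_const 2
      refine (h1.sub h2).congr_deriv ?_
      simp
    · intro x hxm y hym
      have hxm := Ioo_subset_Icc_self hxm
      have hym := Ioo_subset_Icc_self hym
      have h1 := (((hasDerivAt_id y).mul ((hasDerivAt_id y).const_sub (2 * d))).const_add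
        (x ^ 2)).const_mul (A / d ^ 2)
      have h2 := ((hasDerivAt_id y).mul ((hasDerivAt_id y).const_sub d)).const_mul (B / 2)
      have h3 := ((hy x hxm y (hpos y hym)).sub
        (hrefl (h := g x) (h' := gy x) (hy x hxm (-y) (hneg y hym)))).div_const 2
      refine ((h1.add h2).sub h3).congr_deriv ?_
      simp only [id]
      ring
    · intro x hxm y hym
      have hxm := Ioo_subset_Icc_self hxm
      have hym := Ioo_subset_Icc_self hym
      have h1 := ((hasDerivAt_id x).const_mul 2).const_mul (A / d ^ 2)
      have h2 := ((hxx x hxm y (hpos y hym)).sub (hxx x hxm (-y) (hneg y hym))).div_const 2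
      refine (h1.sub h2).congr_deriv ?_
      simp
    · intro x hxm y hym
      have hxm := Ioo_subset_Icc_self hxm
      have hym := Ioo_subset_Icc_self hym
      have h1 := (((hasDerivAt_id y).const_mul 2).const_sub (2 * d)).const_mul (A / d ^ 2)
      have h2 := (((hasDerivAt_id y).const_mul 2).const_sub d).const_mul (B / 2)
      have h3 := ((hyy x hxm y (hpos y hym)).add
        (hrefl (h := gy x) (h' := gyy x) (hyy x hxm (-y) (hneg y hym)))).div_const 2
      refine ((h1.add h2).sub h3).congr_deriv ?_
      ring
    · intro x hxm y hym
      have hxm := Ioo_subset_Icc_self hxm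
      have hym := Ioo_subset_Icc_self hym
      have h1 := abs_lt.1 (hB x hxm y (hpos y hym))
      have h2 := abs_lt.1 (hB x hxm (-y) (hneg y hym))
      linarith [h1.1, h2.2]
    · intro x hxm y hym hbd
      have hosc : (g x y - g x (-y)) / 2 ≤ A := by
        have h1 := abs_le.1 (hA x hxm y (hpos y hym))
        have h2 := abs_le.1 (hA x hxm (-y) (hneg y hym))
        linarith [h1.2, h2.1]
      have hquad : 0 ≤ B / 2 * (y * (d - y)) :=
        mul_nonneg (by linarith) (mul_nonneg hym.1 (by linarith [hym.2]))
      have hy2 : 0 ≤ y * (2 * d - y) := mul_nonneg hym.1 (by linarith [hym.2])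
      by_cases hy0 : y = 0
      · subst hy0
        simp only [neg_zero, sub_self, zero_mul, mul_zero, add_zero, zero_div, sub_zero]
        positivity
      · have hsq : d ^ 2 ≤ x ^ 2 + y * (2 * d - y) := by
          rcases hbd with h | h | h | h
          · subst h; nlinarith
          · subst h; nlinarith
          · exact absurd h hy0
          · subst h; nlinarith [sq_nonneg x]
        have : A ≤ A / d ^ 2 * (x ^ 2 + y * (2 * d - y)) := by
          calc A = A / d ^ 2 * d ^ 2 := by field_simp
            _ ≤ _ := by gcongr
        linarith
  have hder : HasDerivAt (fun y => A / d ^ 2 * (0 ^ 2 + y * (2 * d - y)) + B / 2 * (y * (d - y))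
      - (g 0 y - g 0 (-y)) / 2) (2 * A / d + B * d / 2 - gy 0 0) 0 := by
    have h1 := (((hasDerivAt_id (0 : ℝ)).mul ((hasDerivAt_id (0 : ℝ)).const_sub (2 * d))).const_add
      (0 ^ 2)).const_mul (A / d ^ 2)
    have h2 := ((hasDerivAt_id (0 : ℝ)).mul ((hasDerivAt_id (0 : ℝ)).const_sub d)).const_mul (B / 2)
    have h3 := ((hy 0 h0 0 h0).sub
      (hrefl (h := g 0) (h' := gy 0) (y := 0) (by simpa using hy 0 h0 0 h0))).div_const 2
    refine ((h1.add h2).sub h3).congr_deriv ?_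
    simp only [id, neg_zero]
    field_simp
    ring
  have := hasDerivAt_nonneg_of_nonneg_right hd (by simp) (fun t ht => key t ⟨ht.1.le, ht.2⟩) hder
  linarith

/-- Interior gradient estimate for the Poisson equation on a square. -/
lemma abs_deriv_le_of_laplacian_le {d A B : ℝ} (hd : 0 < d) {g gx gy gxx gyy : ℝ → ℝ → ℝ}
    (hc : ContinuousOn (Function.uncurry g) (Icc (-d) d ×ˢ Icc (-d) d))
    (hx : ∀ x ∈ Icc (-d) d, ∀ y ∈ Icc (-d) d, HasDerivAt (fun t => g t y) (gx x y) x)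
    (hy : ∀ x ∈ Icc (-d) d, ∀ y ∈ Icc (-d) d, HasDerivAt (fun t => g x t) (gy x y) y)
    (hxx : ∀ x ∈ Icc (-d) d, ∀ y ∈ Icc (-d) d, HasDerivAt (fun t => gx t y) (gxx x y) x)
    (hyy : ∀ x ∈ Icc (-d) d, ∀ y ∈ Icc (-d) d, HasDerivAt (fun t => gy x t) (gyy x y) y)
    (hA : ∀ x ∈ Icc (-d) d, ∀ y ∈ Icc (-d) d, |g x y| ≤ A)
    (hB : ∀ x ∈ Icc (-d) d, ∀ y ∈ Icc (-d) d, |gxx x y + gyy x y| ≤ B) :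
    |gy 0 0| ≤ 2 * A / d + B * d / 2 := by
  refine le_of_forall_pos_le_add fun ε hε => ?_
  -- The comparison needs a strict bound on the Laplacian; `2 * ε / d` of slack costs `ε`.
  have hB' : ∀ x ∈ Icc (-d) d, ∀ y ∈ Icc (-d) d, |gxx x y + gyy x y| < B + 2 * ε / d :=
    fun x hx y hy => lt_add_of_le_of_pos (hB x hx y hy) (by positivity)
  have heq : 2 * A / d + (B + 2 * ε / d) * d / 2 = 2 * A / d + B * d / 2 + ε := by
    field_simp
    ring
  rw [← heq, abs_le']
  constructor
  · exact deriv_le_of_laplacian_lt hd hc hx hy hxx hyy hA hB'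
  · refine deriv_le_of_laplacian_lt (g := fun x y => -g x y) (gx := fun x y => -gx x y)
      (gy := fun x y => -gy x y) (gxx := fun x y => -gxx x y) (gyy := fun x y => -gyy x y) hd
      hc.neg (fun x hx' y hy' => (hx x hx' y hy').neg) (fun x hx' y hy' => (hy x hx' y hy').neg)
      (fun x hx' y hy' => (hxx x hx' y hy').neg) (fun x hx' y hy' => (hyy x hx' y hy').neg)
      (fun x hx' y hy' => by simpa using hA x hx' y hy') (fun x hx' y hy' => ?_)
    rw [← neg_add, abs_neg]
    exact hB' x hx' y hy'

/-! ### Interior gradient estimates in the complex plane -/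

/-- The partial derivative `∂F/∂x` of a function on `ℂ`. -/
noncomputable def px (F : ℂ → ℂ) (w : ℂ) : ℂ := fderiv ℝ F w 1

/-- The partial derivative `∂F/∂y` of a function on `ℂ`. -/
noncomputable def py (F : ℂ → ℂ) (w : ℂ) : ℂ := fderiv ℝ F w Complex.I

lemma hasDerivAt_comp_horizontal {H : ℂ → ℂ} (L : ℂ →L[ℝ] ℝ) (z : ℂ) (x y : ℝ)
    (hH : DifferentiableAt ℝ H (z + x + y * Complex.I)) :
    HasDerivAt (fun t : ℝ => L (H (z + t + y * Complex.I)))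
      (L (px H (z + x + y * Complex.I))) x := by
  have h1 : HasDerivAt (fun t : ℝ => z + t + y * Complex.I) 1 x := by
    simpa using (Complex.ofRealCLM.hasDerivAt (x := x)).const_add z |>.add_const (y * Complex.I)
  exact L.hasFDerivAt.comp_hasDerivAt x (hH.hasFDerivAt.comp_hasDerivAt x h1)

lemma hasDerivAt_comp_vertical {H : ℂ → ℂ} (L : ℂ →L[ℝ] ℝ) (z : ℂ) (x y : ℝ)
    (hH : DifferentiableAt ℝ H (z + x + y * Complex.I)) :
    HasDerivAt (fun t : ℝ => L (H (z + x + t * Complex.I)))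
      (L (py H (z + x + y * Complex.I))) y := by
  have h1 : HasDerivAt (fun t : ℝ => z + x + t * Complex.I) Complex.I y := by
    simpa using (((Complex.ofRealCLM.hasDerivAt (x := y)).mul_const Complex.I).const_add (z + x))
  exact L.hasFDerivAt.comp_hasDerivAt y (hH.hasFDerivAt.comp_hasDerivAt y h1)

lemma contDiffOn_px {F : ℂ → ℂ} {U : Set ℂ} (hU : IsOpen U) (hF : ContDiffOn ℝ 2 F U) :
    ContDiffOn ℝ 1 (px F) U :=
  (hF.fderiv_of_isOpen hU (by norm_num)).clm_apply contDiffOn_const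

lemma contDiffOn_py {F : ℂ → ℂ} {U : Set ℂ} (hU : IsOpen U) (hF : ContDiffOn ℝ 2 F U) :
    ContDiffOn ℝ 1 (py F) U :=
  (hF.fderiv_of_isOpen hU (by norm_num)).clm_apply contDiffOn_const

lemma add_mem_closedBall_of_mem_Icc {z : ℂ} {d x y : ℝ} (hx : x ∈ Icc (-d) d)
    (hy : y ∈ Icc (-d) d) : z + x + y * Complex.I ∈ Metric.closedBall z (2 * d) := by
  rw [Metric.mem_closedBall, dist_eq_norm]
  calc ‖z + x + y * Complex.I - z‖ = ‖(x : ℂ) + y * Complex.I‖ := by ring_nf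
    _ ≤ ‖(x : ℂ)‖ + ‖y * Complex.I‖ := norm_add_le _ _
    _ = |x| + |y| := by simp
    _ ≤ 2 * d := by linarith [abs_le.2 hx, abs_le.2 hy]

/-- Interior gradient estimate for the Poisson equation, for complex-valued functions. -/
lemma norm_px_add_norm_py_le {F : ℂ → ℂ} {U : Set ℂ} (hU : IsOpen U) (hF : ContDiffOn ℝ 2 F U)
    {z : ℂ} {d A B : ℝ} (hd : 0 < d) (hball : Metric.closedBall z (2 * d) ⊆ U)
    (hA : ∀ w ∈ Metric.closedBall z (2 * d), ‖F w‖ ≤ A)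
    (hB : ∀ w ∈ Metric.closedBall z (2 * d), ‖px (px F) w + py (py F) w‖ ≤ B) :
    ‖px F z‖ + ‖py F z‖ ≤ 8 * A / d + 2 * B * d := by
  have hmem {x : ℝ} (hx : x ∈ Icc (-d) d) {y : ℝ} (hy : y ∈ Icc (-d) d) :
      z + x + y * Complex.I ∈ Metric.closedBall z (2 * d) := add_mem_closedBall_of_mem_Icc hx hy
  have hdF {w : ℂ} (hw : w ∈ Metric.closedBall z (2 * d)) : DifferentiableAt ℝ F w :=
    (hF.differentiableOn (by norm_num)).differentiableAt (hU.mem_nhds (hball hw))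
  have hdx {w : ℂ} (hw : w ∈ Metric.closedBall z (2 * d)) : DifferentiableAt ℝ (px F) w :=
    ((contDiffOn_px hU hF).differentiableOn (by norm_num)).differentiableAt
      (hU.mem_nhds (hball hw))
  have hdy {w : ℂ} (hw : w ∈ Metric.closedBall z (2 * d)) : DifferentiableAt ℝ (py F) w :=
    ((contDiffOn_py hU hF).differentiableOn (by norm_num)).differentiableAt
      (hU.mem_nhds (hball hw))
  have key (L : ℂ →L[ℝ] ℝ) (hL : ∀ v, |L v| ≤ ‖v‖) :
      |L (px F z)| ≤ 2 * A / d + B * d / 2 ∧ |L (py F z)| ≤ 2 * A / d + B * d / 2 := by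
    have hcont : ContinuousOn (fun p : ℝ × ℝ => L (F (z + p.1 + p.2 * Complex.I)))
        (Icc (-d) d ×ˢ Icc (-d) d) := by
      refine L.continuous.comp_continuousOn (hF.continuousOn.comp ?_ ?_)
      · exact Continuous.continuousOn (by fun_prop)
      · exact fun p hp => hball (hmem hp.1 hp.2)
    have hy := abs_deriv_le_of_laplacian_le hd (A := A) (B := B)
      (g := fun x y => L (F (z + x + y * Complex.I)))
      (gx := fun x y => L (px F (z + x + y * Complex.I)))
      (gy := fun x y => L (py F (z + x + y * Complex.I)))
      (gxx := fun x y => L (px (px F) (z + x + y * Complex.I)))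
      (gyy := fun x y => L (py (py F) (z + x + y * Complex.I)))
      hcont
      (fun x hx y hy => hasDerivAt_comp_horizontal L z x y (hdF (hmem hx hy)))
      (fun x hx y hy => hasDerivAt_comp_vertical L z x y (hdF (hmem hx hy)))
      (fun x hx y hy => hasDerivAt_comp_horizontal L z x y (hdx (hmem hx hy)))
      (fun x hx y hy => hasDerivAt_comp_vertical L z x y (hdy (hmem hx hy)))
      (fun x hx y hy => (hL _).trans (hA _ (hmem hx hy)))
      (fun x hx y hy => by
        rw [← map_add]
        exact (hL _).trans (hB _ (hmem hx hy)))
    have hx := abs_deriv_le_of_laplacian_le hd (A := A) (B := B)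
      (g := fun y x => L (F (z + x + y * Complex.I)))
      (gx := fun y x => L (py F (z + x + y * Complex.I)))
      (gy := fun y x => L (px F (z + x + y * Complex.I)))
      (gxx := fun y x => L (py (py F) (z + x + y * Complex.I)))
      (gyy := fun y x => L (px (px F) (z + x + y * Complex.I)))
      (hcont.comp continuous_swap.continuousOn fun p hp => ⟨hp.2, hp.1⟩)
      (fun y hy x hx => hasDerivAt_comp_vertical L z x y (hdF (hmem hx hy)))
      (fun y hy x hx => hasDerivAt_comp_horizontal L z x y (hdF (hmem hx hy)))
      (fun y hy x hx => hasDerivAt_comp_vertical L z x y (hdy (hmem hx hy)))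
      (fun y hy x hx => hasDerivAt_comp_horizontal L z x y (hdx (hmem hx hy)))
      (fun y hy x hx => (hL _).trans (hA _ (hmem hx hy)))
      (fun y hy x hx => by
        rw [← map_add, add_comm]
        exact (hL _).trans (hB _ (hmem hx hy)))
    simp only [Complex.ofReal_zero, zero_mul, add_zero] at hx hy
    exact ⟨hx, hy⟩
  have hre := key Complex.reCLM fun v => Complex.abs_re_le_norm v
  have him := key Complex.imCLM fun v => Complex.abs_im_le_norm v
  have h1 := Complex.norm_le_abs_re_add_abs_im (px F z)
  have h2 := Complex.norm_le_abs_re_add_abs_im (py F z)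
  simp only [Complex.reCLM_apply, Complex.imCLM_apply] at hre him
  have : 8 * A / d + 2 * B * d = 4 * (2 * A / d + B * d / 2) := by ring
  linarith [hre.1, hre.2, him.1, him.2]

/-- Interior gradient estimate for a solution of `|Δ F| ≤ P + Q |∇ F|` on a disc whose radius is
small compared with `1 / Q`. Applying the estimate for the Poisson equation around a maximum of
`(R - |z - z₀|) |∇ F(z)|` allows the gradient term on the right to be absorbed. -/
lemma mul_norm_px_add_norm_py_le {F : ℂ → ℂ} {U : Set ℂ} (hU : IsOpen U)
    (hF : ContDiffOn ℝ 2 F U) {z₀ : ℂ} {R A P Q : ℝ} (hR : 0 < R)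
    (hball : Metric.closedBall z₀ R ⊆ U) (hP : 0 ≤ P) (hQ : 0 ≤ Q) (hQR : 4 * (Q * R) ≤ 1)
    (hA : ∀ w ∈ Metric.closedBall z₀ R, ‖F w‖ ≤ A)
    (hB : ∀ w ∈ Metric.closedBall z₀ R,
      ‖px (px F) w + py (py F) w‖ ≤ P + Q * (‖px F w‖ + ‖py F w‖)) :
    R * (‖px F z₀‖ + ‖py F z₀‖) ≤ 64 * A + R ^ 2 * P := by
  set G : ℂ → ℝ := fun w => ‖px F w‖ + ‖py F w‖ with hG
  have hG0 (w : ℂ) : 0 ≤ G w := by positivity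
  have hGc : ContinuousOn G (Metric.closedBall z₀ R) :=
    (((contDiffOn_px hU hF).continuousOn.norm).add
      ((contDiffOn_py hU hF).continuousOn.norm)).mono hball
  have hz₀ : z₀ ∈ Metric.closedBall z₀ R := Metric.mem_closedBall_self hR.le
  have hA0 : 0 ≤ A := (norm_nonneg _).trans (hA z₀ hz₀)
  obtain ⟨z, hz, hmax⟩ := (isCompact_closedBall z₀ R).exists_isMaxOn ⟨z₀, hz₀⟩
    (f := fun w => (R - dist w z₀) * G w) (ContinuousOn.mul (by fun_prop) hGc)
  set ρ := R - dist z z₀ with hρ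
  set T := ρ * G z with hT
  have hmax' (w : ℂ) (hw : w ∈ Metric.closedBall z₀ R) : (R - dist w z₀) * G w ≤ T := hmax hw
  have h0 : R * G z₀ ≤ T := by simpa using hmax' z₀ hz₀
  refine h0.trans ?_
  have hρ0 : 0 ≤ ρ := sub_nonneg.2 hz
  rcases hρ0.eq_or_lt with hρ0 | hρ0
  · rw [hT, ← hρ0, zero_mul]
    positivity
  have hρR : ρ ≤ R := by linarith [dist_nonneg (x := z) (y := z₀)]
  -- On the disc of radius `ρ / 2` around `z` the weight is at least `ρ / 2`.
  have hdist (w : ℂ) (hw : w ∈ Metric.closedBall z (2 * (ρ / 4))) : ρ / 2 ≤ R - dist w z₀ := by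
    have := dist_triangle w z z₀
    rw [Metric.mem_closedBall] at hw
    linarith
  have hsub : Metric.closedBall z (2 * (ρ / 4)) ⊆ Metric.closedBall z₀ R := fun w hw => by
    have := hdist w hw
    rw [Metric.mem_closedBall]
    linarith
  have hgrad := norm_px_add_norm_py_le hU hF (z := z) (d := ρ / 4) (A := A)
    (B := P + Q * (2 * T / ρ)) (by positivity) (hsub.trans hball) (fun w hw => hA w (hsub hw))
    (fun w hw => (hB w (hsub hw)).trans (by
      gcongr
      rw [le_div_iff₀ hρ0]
      have h1 := hmax' w (hsub hw)
      have h2 := mul_le_mul_of_nonneg_right (hdist w hw) (hG0 w)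
      change G w * ρ ≤ 2 * T
      linarith))
  have hT' : T ≤ 32 * A + ρ ^ 2 * P / 2 + Q * ρ * T := by
    calc T ≤ ρ * (8 * A / (ρ / 4) + 2 * (P + Q * (2 * T / ρ)) * (ρ / 4)) :=
          mul_le_mul_of_nonneg_left hgrad hρ0.le
      _ = 32 * A + ρ ^ 2 * P / 2 + Q * ρ * T := by
        field_simp
        ring
  have hT0 : 0 ≤ T := mul_nonneg hρ0.le (hG0 z)
  have h1 : Q * ρ * T ≤ 1 / 4 * T := by
    have : Q * ρ ≤ Q * R := by gcongr
    gcongr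
    linarith
  have h2 : ρ ^ 2 * P ≤ R ^ 2 * P := by gcongr
  linarith [mul_nonneg (sq_nonneg ρ) hP]

/-! ### Eigenfunctions on the upper half-plane -/

lemma isOpen_im_pos : IsOpen {w : ℂ | 0 < w.im} := isOpen_lt continuous_const Complex.continuous_im

lemma comp_ofComplex_eventuallyEq {g : ℍ → ℂ} {G : ℂ → ℂ} (h : ∀ z : ℍ, g z = G z) (z : ℍ) :
    g ∘ UpperHalfPlane.ofComplex =ᶠ[𝓝 (z : ℂ)] G := by
  filter_upwards [isOpen_im_pos.mem_nhds z.im_pos] with w hw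
  simp [UpperHalfPlane.ofComplex_apply_of_im_pos hw, h]

lemma dx_dx_eq (f : ℍ → ℂ) (z : ℍ) :
    dx (dx f) z = px (px (f ∘ UpperHalfPlane.ofComplex)) z := by
  rw [dx, (comp_ofComplex_eventuallyEq (g := dx f)
    (G := px (f ∘ UpperHalfPlane.ofComplex)) (fun _ => rfl) z).fderiv_eq, px]

lemma dy_dy_eq (f : ℍ → ℂ) (z : ℍ) :
    dy (dy f) z = py (py (f ∘ UpperHalfPlane.ofComplex)) z := by
  rw [dy, (comp_ofComplex_eventuallyEq (g := dy f)
    (G := py (f ∘ UpperHalfPlane.ofComplex)) (fun _ => rfl) z).fderiv_eq, py]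

lemma im_half_le_of_dist_le {z : ℍ} {w : ℂ} (hw : dist w z ≤ z.im / 16) : z.im / 2 ≤ w.im := by
  have h := (Complex.abs_im_le_norm (w - z)).trans ((dist_eq_norm w (z : ℂ)).symm.le.trans hw)
  rw [Complex.sub_im, UpperHalfPlane.coe_im] at h
  linarith [(abs_le.1 h).1, z.im_pos]

/-- A Euclidean disc of radius `Im z / 16` around `z` lies in the hyperbolic disc of radius `1`. -/
lemma dist_le_one_of_dist_coe_le {z w : ℍ} (hw : dist (w : ℂ) z ≤ z.im / 16) : dist w z ≤ 1 := by
  have him : z.im / 2 ≤ w.im := im_half_le_of_dist_le hw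
  have hz := z.im_pos
  refine (UpperHalfPlane.dist_le_dist_coe_div_sqrt w z).trans ?_
  have hsqrt : z.im / 2 ≤ √(w.im * z.im) := by
    refine Real.le_sqrt_of_sq_le ?_
    nlinarith
  rw [div_le_one (by linarith)]
  linarith

lemma norm_secondDeriv_le {k : ℤ} {s : ℂ} {f : ℍ → ℂ} {w : ℍ} {A b : ℝ} (hb : 0 < b)
    (hbw : b ≤ w.im) (heigen : laplacian k f w + s * (1 - s) * f w = 0) (hA : ‖f w‖ ≤ A) :
    ‖dx (dx f) w + dy (dy f) w‖ ≤ (1 + ‖s‖) ^ 2 * A / b ^ 2 + 2 * |(k : ℝ)| / b * ‖dx f w‖ := by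
  have hy : (0 : ℝ) < w.im := w.im_pos
  have hyc : (w.im : ℂ) ≠ 0 := by exact_mod_cast hy.ne'
  have hA0 : 0 ≤ A := (norm_nonneg _).trans hA
  have heq : dx (dx f) w + dy (dy f) w =
      -(s * (1 - s) * f w) / (w.im : ℂ) ^ 2 + 2 * Complex.I * k / w.im * dx f w := by
    rw [laplacian] at heigen
    field_simp
    linear_combination heigen
  have hs : ‖s‖ * ‖1 - s‖ ≤ (1 + ‖s‖) ^ 2 := by
    have h1 : ‖1 - s‖ ≤ 1 + ‖s‖ := (norm_sub_le _ _).trans (by simp)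
    nlinarith [norm_nonneg s, norm_nonneg (1 - s)]
  have hk : ‖(k : ℂ)‖ = |(k : ℝ)| := by
    rw [← Complex.ofReal_intCast, Complex.norm_real, Real.norm_eq_abs]
  rw [heq]
  refine (norm_add_le _ _).trans (add_le_add ?_ ?_)
  · rw [norm_div, norm_neg, norm_mul, norm_mul, norm_pow, Complex.norm_real, Real.norm_eq_abs,
      abs_of_pos hy]
    gcongr
  · rw [norm_mul, norm_div, norm_mul, norm_mul, hk, Complex.norm_real, Real.norm_eq_abs,
      abs_of_pos hy, Complex.norm_I, Complex.norm_ofNat, mul_one]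
    gcongr

/-- The gradient of an eigenfunction at `z` is controlled by its size on the hyperbolic disc of
radius `1`, with a constant that is linear in `|s|`. The interior gradient estimate is applied on a
Euclidean disc of radius comparable to `Im z / (1 + |s|)`, on which the zeroth-order term
`s (1 - s) f` is harmless. -/
lemma im_mul_gradient_le {k : ℤ} {s : ℂ} {f : ℍ → ℂ}
    (hf : ContDiffOn ℝ 2 (f ∘ UpperHalfPlane.ofComplex) {w : ℂ | 0 < w.im})
    (heigen : ∀ z : ℍ, laplacian k f z + s * (1 - s) * f z = 0) {z : ℍ} {A : ℝ}
    (hA : ∀ w : ℍ, dist w z ≤ 1 → ‖f w‖ ≤ A) :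
    z.im * (‖dx f z‖ + ‖dy f z‖) ≤ 1040 * (|(k : ℝ)| + 1) * (1 + ‖s‖) * A := by
  have hy := z.im_pos
  have hA0 : 0 ≤ A := (norm_nonneg _).trans (hA z (by simp))
  have hs := norm_nonneg s
  have hk := abs_nonneg (k : ℝ)
  set c : ℝ := (|(k : ℝ)| + 1) * (1 + ‖s‖) with hc
  have hc1 : 1 ≤ c := by nlinarith
  have hck : |(k : ℝ)| ≤ c := by nlinarith
  have hcs : 1 + ‖s‖ ≤ c := by nlinarith
  have hc0 : 0 < c := by linarith
  set R : ℝ := z.im / (16 * c) with hRdef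
  have hR : 0 < R := by positivity
  have hR16 : R ≤ z.im / 16 := by
    rw [hRdef]
    gcongr
    linarith
  have hmem (w : ℂ) (hw : w ∈ Metric.closedBall (z : ℂ) R) : z.im / 2 ≤ w.im :=
    im_half_le_of_dist_le ((Metric.mem_closedBall.1 hw).trans hR16)
  have hlift (w : ℂ) (hw : w ∈ Metric.closedBall (z : ℂ) R) :
      ∃ v : ℍ, (v : ℂ) = w ∧ z.im / 2 ≤ v.im ∧ ‖f v‖ ≤ A := by
    have him := hmem w hw
    refine ⟨⟨w, by linarith⟩, rfl, him, hA _ (dist_le_one_of_dist_coe_le ?_)⟩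
    exact (Metric.mem_closedBall.1 hw).trans hR16
  have key := mul_norm_px_add_norm_py_le isOpen_im_pos hf (z₀ := z) (R := R) (A := A)
    (P := (1 + ‖s‖) ^ 2 * A / (z.im / 2) ^ 2) (Q := 2 * |(k : ℝ)| / (z.im / 2)) hR
    (fun w hw => show 0 < w.im by linarith [hmem w hw]) (by positivity) (by positivity)
    (by
      rw [hRdef]
      field_simp
      linarith)
    (fun w hw => by
      obtain ⟨v, rfl, -, hv⟩ := hlift w hw
      simpa using hv)
    (fun w hw => by
      obtain ⟨v, rfl, hvim, hv⟩ := hlift w hw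
      rw [← dx_dx_eq, ← dy_dy_eq]
      refine (norm_secondDeriv_le (by positivity) hvim (heigen v) hv).trans ?_
      gcongr
      exact le_add_of_nonneg_right (norm_nonneg _))
  change R * (‖dx f z‖ + ‖dy f z‖) ≤ _ at key
  have hRP : R ^ 2 * ((1 + ‖s‖) ^ 2 * A / (z.im / 2) ^ 2) ≤ A := by
    have h1 : R ^ 2 * ((1 + ‖s‖) ^ 2 * A / (z.im / 2) ^ 2) = (1 + ‖s‖) ^ 2 / (64 * c ^ 2) * A := by
      rw [hRdef]
      field_simp
      ring
    rw [h1]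
    refine mul_le_of_le_one_left hA0 ((div_le_one (by positivity)).2 ?_)
    nlinarith
  calc z.im * (‖dx f z‖ + ‖dy f z‖) = 16 * c * (R * (‖dx f z‖ + ‖dy f z‖)) := by
        rw [hRdef]
        field_simp
    _ ≤ 16 * c * (64 * A + A) := by gcongr; linarith
    _ = 1040 * (|(k : ℝ)| + 1) * (1 + ‖s‖) * A := by rw [hc]; ring

/-! ### Raising and lowering operators -/

lemma norm_raising_le (k : ℤ) (f : ℍ → ℂ) (z : ℍ) :
    ‖raising k f z‖ ≤ z.im * (‖dx f z‖ + ‖dy f z‖) + |(k : ℝ)| * ‖f z‖ := by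
  have hk : ‖(k : ℂ)‖ = |(k : ℝ)| := by
    rw [← Complex.ofReal_intCast, Complex.norm_real, Real.norm_eq_abs]
  have h : raising k f z = z.im * (Complex.I * (dx f z - Complex.I * dy f z)) + k * f z := by
    rw [raising, dz, Complex.sub_conj, UpperHalfPlane.coe_im]
    push_cast
    ring
  rw [h]
  refine (norm_add_le _ _).trans (add_le_add ?_ (by rw [norm_mul, hk]))
  rw [norm_mul, norm_mul, Complex.norm_I, one_mul, Complex.norm_real, Real.norm_eq_abs,
    abs_of_pos z.im_pos]
  refine mul_le_mul_of_nonneg_left ((norm_sub_le _ _).trans ?_) z.im_pos.le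
  simp

lemma norm_lowering_le (k : ℤ) (f : ℍ → ℂ) (z : ℍ) :
    ‖lowering k f z‖ ≤ z.im * (‖dx f z‖ + ‖dy f z‖) + |(k : ℝ)| * ‖f z‖ := by
  have hk : ‖(k : ℂ)‖ = |(k : ℝ)| := by
    rw [← Complex.ofReal_intCast, Complex.norm_real, Real.norm_eq_abs]
  have h : lowering k f z = z.im * (-Complex.I * (dx f z + Complex.I * dy f z)) - k * f z := by
    rw [lowering, dzbar, ← neg_sub (z : ℂ), Complex.sub_conj, UpperHalfPlane.coe_im]
    push_cast
    ring
  rw [h]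
  refine (norm_sub_le _ _).trans (add_le_add ?_ (by rw [norm_mul, hk]))
  rw [norm_mul, norm_mul, norm_neg, Complex.norm_I, one_mul, Complex.norm_real, Real.norm_eq_abs,
    abs_of_pos z.im_pos]
  refine mul_le_mul_of_nonneg_left ((norm_add_le _ _).trans ?_) z.im_pos.le
  simp

/-! ### Compact sets in the quotient -/

/-- Every compact subset of `Γ\ℍ` has a compact neighbourhood that contains the projection of the
hyperbolic disc of radius `1` around each point above the given set. -/
lemma exists_isCompact_thickening (Γ : Subgroup PSL(2, ℝ)) {C : Set (Surface Γ)}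
    (hC : IsCompact C) :
    ∃ C' : Set (Surface Γ), IsCompact C' ∧
      ∀ z w : ℍ, proj Γ z ∈ C → dist w z ≤ 1 → proj Γ w ∈ C' := by
  have hopen : IsOpenMap (proj Γ) := isOpenMap_quotient_mk'_mul
  have hcont : Continuous (proj Γ) := continuous_quotient_mk'
  obtain ⟨t, ht⟩ := hC.elim_finite_subcover (fun p : ℍ => proj Γ '' Metric.ball p 1)
    (fun p => hopen _ Metric.isOpen_ball) (fun q _ => by
      obtain ⟨p, rfl⟩ := Quotient.exists_rep q
      exact mem_iUnion.2 ⟨p, p, Metric.mem_ball_self one_pos, rfl⟩)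
  refine ⟨proj Γ '' ⋃ p ∈ t, Metric.closedBall p 2,
    (t.isCompact_biUnion fun p _ => isCompact_closedBall p 2).image hcont, fun z w hz hw => ?_⟩
  obtain ⟨p, hpt, v, hv, hvz⟩ := by simpa only [mem_iUnion, exists_prop] using ht hz
  obtain ⟨γ, hγ⟩ : ∃ γ : lift Γ, γ • z = v := MulAction.orbitRel_apply.1 (Quotient.exact hvz)
  -- The isometry `γ` moves `z` into the unit disc around `p`, hence `w` into the disc of radius `2`.
  refine ⟨γ • w, mem_iUnion₂.2 ⟨p, hpt, ?_⟩, Quotient.sound ⟨γ, rfl⟩⟩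
  have hdist : dist (γ • w) (γ • z) = dist w z := dist_smul (γ : SL(2, ℝ)) w z
  rw [Metric.mem_closedBall]
  rw [Metric.mem_ball, ← hγ] at hv
  linarith [dist_triangle (γ • w) (γ • z) p]

lemma supNorm_le_of_norm_le {Γ : Subgroup PSL(2, ℝ)} {C C' : Set (Surface Γ)} {f g : ℍ → ℂ}
    {m : ℝ≥0} {s : ℂ} (hm : m ≠ 0) (hs : s ≠ 0)
    (h : ∀ z : ℍ, proj Γ z ∈ C → ∀ A : ℝ, (∀ w : ℍ, proj Γ w ∈ C' → ‖f w‖ ≤ A) →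
      ‖g z‖ ≤ m * ‖s‖ * A) :
    supNorm Γ C g ≤ m * ‖s‖ₑ * supNorm Γ C' f := by
  by_cases htop : supNorm Γ C' f = ⊤
  · rw [htop, ENNReal.mul_top (mul_ne_zero (by simpa using hm) (by simpa using hs))]
    exact le_top
  refine iSup₂_le fun z hz => ?_
  have hz' := h z hz (supNorm Γ C' f).toReal fun w hw => by
    rw [← toReal_enorm]
    exact ENNReal.toReal_mono htop (le_iSup₂ (f := fun (z : ℍ) (_ : z ∈ {z | proj Γ z ∈ C'}) =>
      ‖f z‖ₑ) w hw)
  rw [← ofReal_norm]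
  refine (ENNReal.ofReal_le_ofReal hz').trans ?_
  rw [ENNReal.ofReal_mul (by positivity), ENNReal.ofReal_mul (by positivity),
    ENNReal.ofReal_toReal htop, ofReal_norm, ENNReal.ofReal_coe_nnreal]

end WeightK

theorem mainTheorem10 (k : ℤ) (δ : ℝ) (hδ : 0 < δ) :
    ∃ M : ℝ≥0, ∀ (Γ : Subgroup PSL(2, ℝ)), DiscreteTopology Γ →
      ∀ C : Set (WeightK.Surface Γ), IsCompact C →
        ∃ C' : Set (WeightK.Surface Γ), IsCompact C' ∧ C ⊆ C' ∧
          ∀ (s : ℂ) (f : ℍ → ℂ), δ ≤ ‖s‖ → WeightK.IsEigenfunction Γ k s f →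
            WeightK.supNorm Γ C (WeightK.raising k f) ≤
                M * ‖s‖ₑ * WeightK.supNorm Γ C' f ∧
              WeightK.supNorm Γ C (WeightK.lowering k f) ≤
                M * ‖s‖ₑ * WeightK.supNorm Γ C' f := by
  have hk := abs_nonneg (k : ℝ)
  have hm0 : 0 < 1041 * (|(k : ℝ)| + 1) * (1 + δ⁻¹) := by positivity
  refine ⟨⟨1041 * (|(k : ℝ)| + 1) * (1 + δ⁻¹), hm0.le⟩, fun Γ _ C hC => ?_⟩
  obtain ⟨C', hC', hCC'⟩ := WeightK.exists_isCompact_thickening Γ hC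
  refine ⟨C', hC', fun q hq => ?_, fun s f hδs hf => ?_⟩
  · obtain ⟨z, rfl⟩ := Quotient.exists_rep q
    exact hCC' z z hq (by simp)
  have hs0 : s ≠ 0 := norm_pos_iff.1 (hδ.trans_le hδs)
  have hs1 : 1 + ‖s‖ ≤ (1 + δ⁻¹) * ‖s‖ := by
    have : 1 ≤ δ⁻¹ * ‖s‖ := by
      rw [inv_mul_eq_div]
      exact (one_le_div hδ).2 hδs
    linarith
  have key (z : ℍ) (hz : WeightK.proj Γ z ∈ C) (A : ℝ)
      (hA : ∀ w : ℍ, WeightK.proj Γ w ∈ C' → ‖f w‖ ≤ A) :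
      z.im * (‖WeightK.dx f z‖ + ‖WeightK.dy f z‖) + |(k : ℝ)| * ‖f z‖ ≤
        1041 * (|(k : ℝ)| + 1) * (1 + δ⁻¹) * ‖s‖ * A := by
    have hball (w : ℍ) (hw : dist w z ≤ 1) : ‖f w‖ ≤ A := hA w (hCC' z w hz hw)
    have hfz := hball z (by simp)
    have hA0 : 0 ≤ A := (norm_nonneg _).trans hfz
    have h1 := WeightK.im_mul_gradient_le hf.contDiffOn hf.eigen hball
    calc z.im * (‖WeightK.dx f z‖ + ‖WeightK.dy f z‖) + |(k : ℝ)| * ‖f z‖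
        ≤ 1040 * (|(k : ℝ)| + 1) * (1 + ‖s‖) * A + (|(k : ℝ)| + 1) * (1 + ‖s‖) * A := by
          gcongr
          nlinarith [norm_nonneg s]
      _ = 1041 * (|(k : ℝ)| + 1) * (1 + ‖s‖) * A := by ring
      _ ≤ 1041 * (|(k : ℝ)| + 1) * ((1 + δ⁻¹) * ‖s‖) * A := by gcongr
      _ = 1041 * (|(k : ℝ)| + 1) * (1 + δ⁻¹) * ‖s‖ * A := by ring
  have hm : (⟨1041 * (|(k : ℝ)| + 1) * (1 + δ⁻¹), hm0.le⟩ : ℝ≥0) ≠ 0 :=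
    fun h => hm0.ne' (congrArg NNReal.toReal h)
  exact ⟨WeightK.supNorm_le_of_norm_le hm hs0 fun z hz A hA =>
      (WeightK.norm_raising_le k f z).trans (key z hz A hA),
    WeightK.supNorm_le_of_norm_le hm hs0 fun z hz A hA =>
      (WeightK.norm_lowering_le k f z).trans (key z hz A hA)⟩
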